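/- Fix $C_1>1$ and a sequence $(k_i)_{i\ge 0}$ of positive integers with $k_{i+1}>2k_i$ for all $i$, and let $S=\{k_i : i\ge 0\}$. For real numbers $\lambda, C_2$ with $1<\lambda<C_1<C_2$ put, for integers $k\ge 1$, $$t_k=\exp(\lambda^k),\qquad p_k'=\begin{cases}\exp(-\lambda^k/C_2), & k\in S,\\ \exp(-\lambda^k/C_1), & k\notin S,\end{cases}\qquad Z=\sum_{k\ge 1}p_k'.$$ (i) For all such $\lambda, C_2$ one has $Z<\infty$, so there is a discrete, almost surely positive random variable $\xi$ with $\mathbb P(\xi=t_k)=p_k'/Z$ for $k\ge1$. Its tail exponent oscillates: $$\liminf_{t\to\infty}\frac{\log\mathbb P(\xi\ge t)}{\log t}=-\frac{\lambda}{C_1}<-\frac1{C_2}=\limsup_{t\to\infty}\frac{\log\mathbb P(\xi\ge t)}{\log t}.$$ There is a probability space carrying a sequence $(A_n)_{n\ge 1}$ in which each $A_n$ is an $n\times n$ random matrix with independent entries distributed as $\xi$. For every such sequence (with arbitrary dependence between different $n$), almost surely $$\liminf_{n\to\infty}\frac{\log\operatorname{perm}A_n}{n\log n}\le C_1\qquad\text{and}\qquad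 \limsup_{n\to\infty}\frac{\log\operatorname{perm}A_n}{n\log n}=C_2>C_1,$$ where $\operatorname{perm}(a_{ij})=\sum_{\pi\in S_n}\prod_{i=1}^n a_{i\pi(i)}$. In particular, almost surely $\frac{\log\operatorname{perm}A_n}{n\log n}$ has no limit in $[-\infty,\infty]$ as $n\to\infty$. Thus the limit need not exist when $\log\mathbb P(\xi\ge t)/\log t$ does not converge as $t\to\infty$. (ii) The oscillation can be arbitrarily small: for every $\varepsilon>0$ the numbers $\lambda, C_2$ with $1<\lambda<C_1<C_2$ can be chosen such that $$\limsup_{t\to\infty}\frac{\log\mathbb P(\xi\ge t)}{\log t}-\liminf_{t\to\infty}\frac{\log\mathbb P(\xi\ge t)}{\log t}<\varepsilon .$$ -/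

import Mathlib

open MeasureTheory ProbabilityTheory Filter

noncomputable section

/-- The atoms `t_j = exp (lam ^ j)`. -/
def oscAtom (lam : ℝ) (j : ℕ) : ℝ := Real.exp (lam ^ j)

open Classical in
/-- The unnormalized weights: `exp (-lam ^ j / C₂)` if `j ∈ S`, and `exp (-lam ^ j / C₁)` if not. -/
def oscWeight (lam C₁ C₂ : ℝ) (S : Set ℕ) (j : ℕ) : ℝ :=
  if j ∈ S then Real.exp (-(lam ^ j / C₂)) else Real.exp (-(lam ^ j / C₁))

/-- The normalizing constant: the sum of the weights over all `j ≥ 1`. -/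
def oscNorm (lam C₁ C₂ : ℝ) (S : Set ℕ) : ℝ :=
  ∑' j : ℕ, oscWeight lam C₁ C₂ S (j + 1)

/-- The discrete law on `ℝ` giving mass `oscWeight j / oscNorm` to the atom `t_j`, `j ≥ 1`. -/
def oscLaw (lam C₁ C₂ : ℝ) (S : Set ℕ) : Measure ℝ :=
  Measure.sum fun j : ℕ =>
    ENNReal.ofReal (oscWeight lam C₁ C₂ S (j + 1) / oscNorm lam C₁ C₂ S) •
      Measure.dirac (oscAtom lam (j + 1))

/-- The tail exponent `log P(ξ ≥ t) / log t` of a random variable with law `μ`. -/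
def tailExponent (μ : Measure ℝ) (t : ℝ) : ℝ :=
  Real.log (μ.real (Set.Ici t)) / Real.log t

/-- `A n` is, for each `n`, an `n × n` random matrix with independent entries of law `μ`, all
defined on one probability space; nothing is said about the joint law for different `n`. -/
structure IsIIDMatrixSequence {Ω : Type*} [MeasurableSpace Ω] (P : Measure Ω) (μ : Measure ℝ)
    (A : (n : ℕ) → Ω → Matrix (Fin n) (Fin n) ℝ) : Prop where
  hasLaw : ∀ (n : ℕ) (i j : Fin n), HasLaw (fun ω => A n ω i j) μ P
  indep : ∀ n : ℕ, iIndepFun (fun (ij : Fin n × Fin n) (ω : Ω) => A n ω ij.1 ij.2) P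

/-- `log (perm M) / (n log n)` for an `n × n` matrix `M`. -/
def logPermRatio {n : ℕ} (M : Matrix (Fin n) (Fin n) ℝ) : ℝ :=
  Real.log M.permanent / (n * Real.log n)

end

/-! ### Moments and tails of the oscillating law. -/

noncomputable section

/-! Away from the sparse indices `k i` the law behaves as if its tail index were `1 / C₁`; the heavy
atoms at `k i` have index `1 / C₂`. Which behaviour an `n × n` matrix sees depends on `n`.

Upper bounds. For `β ≤ 1`, subadditivity of `x ^ β` gives `E perm ^ β ≤ n! * (E ξ ^ β) ^ n`, so by
Markov and `n! ≤ n ^ n` the event `perm ≥ n ^ (D n)` has probability at most `(m * n ^ (1 - β D)) ^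
n`, with `m` the moment (`pi_le_permanent_le`, `factorial_mul_pow_mul_exp_le`). Taking `1 / D < β <
1 / C₂` gives limsup at most `C₂`. When `n` is about `exp (lam ^ k (i + 1) / (4 * C₂))`, with high
probability no entry reaches the atom of index `k (i + 1)`. The moment truncated there is controlled
for all `β < 1 / C₁`: it is `O(exp (lam ^ k i / C₁))`, negligible against any positive power of `n`
because `k` more than doubles. Hence liminf at most `C₁`.

Lower bound. For `n` about `exp ((1 + δ) * lam ^ k i / C₂)`, with high probability every block with
more than `δ n` rows and columns has an entry at least `exp (lam ^ k i)`. A permutation with the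
most such entries then has at least `(1 - δ) n` of them (`le_log_permanent`), and the other entries
are at least `1`. Letting `δ` shrink gives limsup at least `C₂`.

All exceptional probabilities are summable, so the first Borel–Cantelli lemma suffices and the
dependence between different `n` is irrelevant. -/

theorem summable_exp_neg_mul_pow {c lam : ℝ} (hc : 0 < c) (hlam : 1 < lam) :
    Summable fun j : ℕ => Real.exp (-(c * lam ^ j)) := by
  have hr : Real.exp (-(c * (lam - 1))) < 1 := by
    rw [Real.exp_lt_one_iff]
    have := mul_pos hc (sub_pos.2 hlam)
    linarith
  refine Summable.of_nonneg_of_le (fun j => (Real.exp_pos _).le) (fun j => ?_)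
    (summable_geometric_of_lt_one (Real.exp_pos _).le hr)
  rw [← Real.exp_nat_mul, Real.exp_le_exp]
  -- Bernoulli's inequality reduces the doubly exponential decay to a geometric series.
  have h := one_add_mul_le_pow (a := lam - 1) (by linarith) j
  have h2 : (j : ℝ) * (lam - 1) ≤ lam ^ j := by
    have : 1 + (lam - 1) = lam := by ring
    rw [this] at h
    linarith
  nlinarith [mul_le_mul_of_nonneg_left h2 hc.le]

variable {lam C₁ C₂ : ℝ} {S : Set ℕ}

theorem oscWeight_pos (lam C₁ C₂ : ℝ) (S : Set ℕ) (j : ℕ) : 0 < oscWeight lam C₁ C₂ S j := by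
  unfold oscWeight
  split_ifs <;> exact Real.exp_pos _

theorem oscWeight_of_mem {j : ℕ} (h : j ∈ S) :
    oscWeight lam C₁ C₂ S j = Real.exp (-(lam ^ j / C₂)) := if_pos h

theorem oscWeight_of_notMem {j : ℕ} (h : j ∉ S) :
    oscWeight lam C₁ C₂ S j = Real.exp (-(lam ^ j / C₁)) := if_neg h

theorem exp_neg_div_mono {x a b : ℝ} (hx : 0 ≤ x) (ha : 0 < a) (hab : a ≤ b) :
    Real.exp (-(x / a)) ≤ Real.exp (-(x / b)) := by
  rw [Real.exp_le_exp, neg_le_neg_iff]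
  exact div_le_div_of_nonneg_left hx ha hab

theorem oscWeight_le (hlam : 0 ≤ lam) (h₁ : 0 < C₁) (h₁₂ : C₁ ≤ C₂) (S : Set ℕ) (j : ℕ) :
    oscWeight lam C₁ C₂ S j ≤ Real.exp (-(lam ^ j / C₂)) := by
  by_cases h : j ∈ S
  · exact (oscWeight_of_mem h).le
  · rw [oscWeight_of_notMem h]
    exact exp_neg_div_mono (pow_nonneg hlam j) h₁ h₁₂

theorem le_oscWeight (hlam : 0 ≤ lam) (h₁ : 0 < C₁) (h₁₂ : C₁ ≤ C₂) (S : Set ℕ) (j : ℕ) :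
    Real.exp (-(lam ^ j / C₁)) ≤ oscWeight lam C₁ C₂ S j := by
  by_cases h : j ∈ S
  · rw [oscWeight_of_mem h]
    exact exp_neg_div_mono (pow_nonneg hlam j) h₁ h₁₂
  · exact (oscWeight_of_notMem h).ge

theorem summable_oscWeight (hlam : 1 < lam) (h₁ : 0 < C₁) (h₁₂ : C₁ ≤ C₂) (S : Set ℕ) :
    Summable fun j : ℕ => oscWeight lam C₁ C₂ S (j + 1) := by
  have h := (summable_nat_add_iff 1).2
    (summable_exp_neg_mul_pow (inv_pos.2 (h₁.trans_le h₁₂)) hlam)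
  refine Summable.of_nonneg_of_le (fun j => (oscWeight_pos ..).le) (fun j => ?_) h
  refine (oscWeight_le (by linarith) h₁ h₁₂ S _).trans (le_of_eq ?_)
  rw [div_eq_inv_mul]

theorem oscNorm_pos (hlam : 1 < lam) (h₁ : 0 < C₁) (h₁₂ : C₁ ≤ C₂) (S : Set ℕ) :
    0 < oscNorm lam C₁ C₂ S :=
  (summable_oscWeight hlam h₁ h₁₂ S).tsum_pos (fun _ => (oscWeight_pos ..).le) 0
    (oscWeight_pos ..)

theorem lintegral_oscLaw (f : ℝ → ENNReal) :
    ∫⁻ x, f x ∂(oscLaw lam C₁ C₂ S) = ∑' j : ℕ,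
      ENNReal.ofReal (oscWeight lam C₁ C₂ S (j + 1) / oscNorm lam C₁ C₂ S) *
        f (oscAtom lam (j + 1)) := by
  simp [oscLaw, lintegral_sum_measure, lintegral_smul_measure, lintegral_dirac]

theorem isProbabilityMeasure_oscLaw (hlam : 1 < lam) (h₁ : 0 < C₁) (h₁₂ : C₁ ≤ C₂) (S : Set ℕ) :
    IsProbabilityMeasure (oscLaw lam C₁ C₂ S) := by
  constructor
  have hZ := oscNorm_pos hlam h₁ h₁₂ S
  rw [← lintegral_one, lintegral_oscLaw]
  simp only [mul_one]
  rw [← ENNReal.ofReal_tsum_of_nonneg (fun j => (div_pos (oscWeight_pos ..) hZ).le)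
    ((summable_oscWeight hlam h₁ h₁₂ S).div_const _), tsum_div_const]
  rw [show ∑' j : ℕ, oscWeight lam C₁ C₂ S (j + 1) = oscNorm lam C₁ C₂ S from rfl,
    div_self hZ.ne', ENNReal.ofReal_one]

theorem ae_oscLaw_of_forall {p : ℝ → Prop} (hp : ∀ j : ℕ, p (oscAtom lam (j + 1))) :
    ∀ᵐ x ∂(oscLaw lam C₁ C₂ S), p x := by
  rw [oscLaw, Measure.ae_sum_iff]
  intro j
  refine Measure.ae_smul_measure ?_ _
  rw [ae_dirac_eq]
  exact hp j

theorem one_le_oscAtom (hlam : 0 ≤ lam) (j : ℕ) : 1 ≤ oscAtom lam j :=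
  Real.one_le_exp (pow_nonneg hlam j)

/-- A constant controlling integrals against `oscLaw` of functions dominated by
`exp (-c * lam ^ j)` at the atoms. -/
def oscConst (lam C₁ C₂ : ℝ) (S : Set ℕ) (c : ℝ) : ℝ :=
  (∑' j : ℕ, Real.exp (-(c * lam ^ (j + 1)))) / oscNorm lam C₁ C₂ S

theorem oscConst_pos (hlam : 1 < lam) (h₁ : 0 < C₁) (h₁₂ : C₁ ≤ C₂) (S : Set ℕ) {c : ℝ}
    (hc : 0 < c) : 0 < oscConst lam C₁ C₂ S c := by
  refine div_pos ?_ (oscNorm_pos hlam h₁ h₁₂ S)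
  exact ((summable_nat_add_iff 1).2 (summable_exp_neg_mul_pow hc hlam)).tsum_pos
    (fun _ => (Real.exp_pos _).le) 0 (Real.exp_pos _)

/-- The common source of the moment and tail bounds: the constant depends on `c` but not on `B`, so
`B` may vary with the scale. -/
theorem lintegral_oscLaw_le (hlam : 1 < lam) (h₁ : 0 < C₁) (h₁₂ : C₁ ≤ C₂) {c B : ℝ}
    (hc : 0 < c) (hB : 0 ≤ B) {g : ℝ → ℝ}
    (hg : ∀ j : ℕ, oscWeight lam C₁ C₂ S j * g (oscAtom lam j) ≤ B * Real.exp (-(c * lam ^ j))) :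
    ∫⁻ x, ENNReal.ofReal (g x) ∂(oscLaw lam C₁ C₂ S)
      ≤ ENNReal.ofReal (B * oscConst lam C₁ C₂ S c) := by
  have hZ := oscNorm_pos hlam h₁ h₁₂ S
  have hs := (summable_nat_add_iff 1).2 (summable_exp_neg_mul_pow hc hlam)
  have hs2 : Summable fun j : ℕ =>
      B * Real.exp (-(c * lam ^ (j + 1))) / oscNorm lam C₁ C₂ S := (hs.mul_left B).div_const _
  rw [lintegral_oscLaw]
  have : B * oscConst lam C₁ C₂ S c
      = ∑' j : ℕ, B * Real.exp (-(c * lam ^ (j + 1))) / oscNorm lam C₁ C₂ S := by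
    rw [tsum_div_const, tsum_mul_left, oscConst, mul_div_assoc]
  rw [this, ENNReal.ofReal_tsum_of_nonneg (fun j => by positivity) hs2]
  refine ENNReal.tsum_le_tsum fun j => ?_
  rw [← ENNReal.ofReal_mul (div_pos (oscWeight_pos ..) hZ).le]
  refine ENNReal.ofReal_le_ofReal ?_
  rw [div_mul_eq_mul_div]
  exact div_le_div_of_nonneg_right (hg (j + 1)) hZ.le

theorem oscLaw_Ici_le (hlam : 1 < lam) (h₁ : 0 < C₁) (h₁₂ : C₁ ≤ C₂) {c B t : ℝ}
    (hc : 0 < c) (hB : 0 ≤ B)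
    (hg : ∀ j : ℕ, t ≤ oscAtom lam j →
      oscWeight lam C₁ C₂ S j ≤ B * Real.exp (-(c * lam ^ j))) :
    (oscLaw lam C₁ C₂ S) (Set.Ici t) ≤ ENNReal.ofReal (B * oscConst lam C₁ C₂ S c) := by
  have h := lintegral_oscLaw_le (S := S) (g := (Set.Ici t).indicator 1) hlam h₁ h₁₂ hc hB (by
    intro j
    by_cases h : t ≤ oscAtom lam j
    · rw [Set.indicator_of_mem (by exact h)]
      simpa using hg j h
    · rw [Set.indicator_of_notMem (by exact h), mul_zero]
      positivity)
  refine le_trans (le_of_eq ?_) h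
  rw [← lintegral_indicator_one measurableSet_Ici]
  congr 1
  ext x
  by_cases hx : x ∈ Set.Ici t <;> simp [Set.indicator, hx]

theorem le_oscLaw_Ici (hlam : 1 < lam) (h₁ : 0 < C₁) (h₁₂ : C₁ ≤ C₂) {j : ℕ} (hj : 0 < j)
    {t : ℝ} (ht : t ≤ oscAtom lam j) :
    oscWeight lam C₁ C₂ S j / oscNorm lam C₁ C₂ S ≤ (oscLaw lam C₁ C₂ S).real (Set.Ici t) := by
  have := isProbabilityMeasure_oscLaw hlam h₁ h₁₂ S
  obtain ⟨i, rfl⟩ : ∃ i, j = i + 1 := ⟨j - 1, by omega⟩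
  rw [Measure.real, ← ENNReal.ofReal_le_iff_le_toReal (measure_ne_top _ _),
    ← lintegral_indicator_one measurableSet_Ici, lintegral_oscLaw]
  refine le_trans (le_of_eq ?_) (ENNReal.le_tsum i)
  rw [Set.indicator_of_mem (by exact ht)]
  simp

/-- Markov's inequality for `oscLaw`, with a moment of order `γ < 1 / C₂`. -/
theorem oscLaw_Ici_le_exp (hlam : 1 < lam) (h₁ : 0 < C₁) (h₁₂ : C₁ ≤ C₂) {γ s : ℝ} (hγ : 0 < γ)
    (hγ₂ : γ < 1 / C₂) :
    (oscLaw lam C₁ C₂ S) (Set.Ici (Real.exp s)) ≤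
      ENNReal.ofReal (Real.exp (-(γ * s)) * oscConst lam C₁ C₂ S (1 / C₂ - γ)) := by
  refine oscLaw_Ici_le hlam h₁ h₁₂ (sub_pos.2 hγ₂) (Real.exp_pos _).le fun j hj => ?_
  refine (oscWeight_le (by linarith) h₁ h₁₂ S j).trans ?_
  rw [← Real.exp_add, Real.exp_le_exp]
  have hs : s ≤ lam ^ j := Real.exp_le_exp.1 hj
  have := mul_le_mul_of_nonneg_left hs hγ.le
  have e : lam ^ j / C₂ = 1 / C₂ * lam ^ j := by ring
  rw [e]
  linarith

end

/-! ### Liminf and limsup of the tail exponent. -/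

noncomputable section

section ERealLimits

variable {α : Type*} {l : Filter α} {f : α → ℝ} {C : ℝ}

/-- Real levels suffice by density in `EReal`, where liminf and limsup carry no boundedness
conditions. The next three criteria are analogous. -/
theorem limsup_coe_le_of_forall (h : ∀ D, C < D → ∀ᶠ x in l, f x ≤ D) :
    limsup (fun x => (f x : EReal)) l ≤ (C : EReal) := by
  refine EReal.le_of_forall_lt_iff_le.1 fun D hD => ?_
  refine limsup_le_of_le (by isBoundedDefault) ?_
  filter_upwards [h D (EReal.coe_lt_coe_iff.1 hD)] with x hx
  exact EReal.coe_le_coe_iff.2 hx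

theorem le_limsup_coe_of_forall (h : ∀ D, D < C → ∃ᶠ x in l, D ≤ f x) :
    (C : EReal) ≤ limsup (fun x => (f x : EReal)) l := by
  refine EReal.ge_of_forall_gt_iff_ge.1 fun D hD => ?_
  refine le_limsup_of_frequently_le ?_ (by isBoundedDefault)
  exact (h D (EReal.coe_lt_coe_iff.1 hD)).mono fun x hx => EReal.coe_le_coe_iff.2 hx

theorem liminf_coe_le_of_forall (h : ∀ D, C < D → ∃ᶠ x in l, f x ≤ D) :
    liminf (fun x => (f x : EReal)) l ≤ (C : EReal) := by
  refine EReal.le_of_forall_lt_iff_le.1 fun D hD => ?_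
  refine liminf_le_of_frequently_le ?_ (by isBoundedDefault)
  exact (h D (EReal.coe_lt_coe_iff.1 hD)).mono fun x hx => EReal.coe_le_coe_iff.2 hx

theorem le_liminf_coe_of_forall (h : ∀ D, D < C → ∀ᶠ x in l, D ≤ f x) :
    (C : EReal) ≤ liminf (fun x => (f x : EReal)) l := by
  refine EReal.ge_of_forall_gt_iff_ge.1 fun D hD => ?_
  refine le_liminf_of_le (by isBoundedDefault) ?_
  filter_upwards [h D (EReal.coe_lt_coe_iff.1 hD)] with x hx
  exact EReal.coe_le_coe_iff.2 hx

end ERealLimits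

variable {lam C₁ C₂ : ℝ} {S : Set ℕ} {k : ℕ → ℕ}

theorem strictMono_of_two_mul_lt (hk : ∀ i, 2 * k i < k (i + 1)) : StrictMono k :=
  strictMono_nat_of_lt_succ fun i => by have := hk i; omega

theorem tendsto_pow_comp_atTop (hlam : 1 < lam) (hk : ∀ i, 2 * k i < k (i + 1)) :
    Tendsto (fun i => lam ^ k i) atTop atTop :=
  (tendsto_pow_atTop_atTop_of_one_lt hlam).comp (strictMono_of_two_mul_lt hk).tendsto_atTop

theorem oscLaw_real_Ici_pos (hlam : 1 < lam) (h₁ : 0 < C₁) (h₁₂ : C₁ ≤ C₂) (t : ℝ) :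
    0 < (oscLaw lam C₁ C₂ S).real (Set.Ici t) := by
  have ht : Tendsto (oscAtom lam) atTop atTop :=
    Real.tendsto_exp_atTop.comp (tendsto_pow_atTop_atTop_of_one_lt hlam)
  obtain ⟨j, hj, hj0⟩ := ((ht.eventually_ge_atTop t).and (eventually_gt_atTop 0)).exists
  exact (div_pos (oscWeight_pos ..) (oscNorm_pos hlam h₁ h₁₂ S)).trans_le
    (le_oscLaw_Ici hlam h₁ h₁₂ hj0 hj)

/-- An exponential upper bound on the tail at `exp s` bounds the tail exponent. -/
theorem tailExponent_exp_le (hlam : 1 < lam) (h₁ : 0 < C₁) (h₁₂ : C₁ ≤ C₂) {s a K : ℝ}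
    (hs : 0 < s) (hK : 0 < K)
    (h : (oscLaw lam C₁ C₂ S) (Set.Ici (Real.exp s)) ≤ ENNReal.ofReal (Real.exp (-a) * K)) :
    tailExponent (oscLaw lam C₁ C₂ S) (Real.exp s) ≤ (-a + Real.log K) / s := by
  have := isProbabilityMeasure_oscLaw hlam h₁ h₁₂ S
  have h' : (oscLaw lam C₁ C₂ S).real (Set.Ici (Real.exp s)) ≤ Real.exp (-a) * K :=
    ENNReal.toReal_le_of_le_ofReal (by positivity) h
  rw [tailExponent, Real.log_exp]
  refine div_le_div_of_nonneg_right ?_ hs.le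
  refine (Real.log_le_log (oscLaw_real_Ici_pos hlam h₁ h₁₂ _) h').trans (le_of_eq ?_)
  rw [Real.log_mul (Real.exp_ne_zero _) hK.ne', Real.log_exp]

/-- An exponential lower bound on an atom above `exp s` bounds the tail exponent at `exp s`. -/
theorem le_tailExponent_exp (hlam : 1 < lam) (h₁ : 0 < C₁) (h₁₂ : C₁ ≤ C₂) {s a : ℝ}
    (hs : 0 < s) {j : ℕ} (hj : 0 < j) (hsj : s ≤ lam ^ j)
    (h : Real.exp (-a) ≤ oscWeight lam C₁ C₂ S j) :
    (-a - Real.log (oscNorm lam C₁ C₂ S)) / s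
      ≤ tailExponent (oscLaw lam C₁ C₂ S) (Real.exp s) := by
  have hZ := oscNorm_pos hlam h₁ h₁₂ S
  have h' : Real.exp (-a) / oscNorm lam C₁ C₂ S
      ≤ (oscLaw lam C₁ C₂ S).real (Set.Ici (Real.exp s)) :=
    (div_le_div_of_nonneg_right h hZ.le).trans
      (le_oscLaw_Ici hlam h₁ h₁₂ hj (Real.exp_le_exp.2 hsj))
  rw [tailExponent, Real.log_exp]
  refine div_le_div_of_nonneg_right ?_ hs.le
  refine le_trans (le_of_eq ?_) (Real.log_le_log (by positivity) h')
  rw [Real.log_div (Real.exp_ne_zero _) hZ.ne', Real.log_exp]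

theorem eventually_tailExponent_le (hlam : 1 < lam) (h₁ : 0 < C₁) (h₁₂ : C₁ ≤ C₂) {D : ℝ}
    (hD : -(1 / C₂) < D) :
    ∀ᶠ t in atTop, tailExponent (oscLaw lam C₁ C₂ S) t ≤ D := by
  have h₂ : 0 < C₂ := h₁.trans_le h₁₂
  obtain ⟨γ, hγ, hγ₂⟩ := exists_between (show max 0 (-D) < 1 / C₂ from
    max_lt (by positivity) (by linarith))
  have hγ0 := (le_max_left _ _).trans_lt hγ
  have hγD := (le_max_right _ _).trans_lt hγ
  set K := oscConst lam C₁ C₂ S (1 / C₂ - γ)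
  have hlim : Tendsto (fun t => -γ + Real.log K / Real.log t) atTop (nhds (-γ + 0)) :=
    (tendsto_const_nhds.div_atTop Real.tendsto_log_atTop).const_add _
  filter_upwards [hlim.eventually (gt_mem_nhds (show -γ + 0 < D by linarith)),
    eventually_gt_atTop 1] with t ht ht1
  have hs : 0 < Real.log t := Real.log_pos ht1
  have h := tailExponent_exp_le (S := S) hlam h₁ h₁₂ hs
    (oscConst_pos hlam h₁ h₁₂ S (sub_pos.2 hγ₂)) (oscLaw_Ici_le_exp hlam h₁ h₁₂ hγ0 hγ₂)
  rw [Real.exp_log (by linarith)] at h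
  refine h.trans (le_trans (le_of_eq ?_) ht.le)
  rw [add_div, neg_div, mul_div_cancel_right₀ _ hs.ne']

theorem frequently_le_tailExponent (hlam : 1 < lam) (h₁ : 0 < C₁) (h₁₂ : C₁ ≤ C₂)
    (hk0 : ∀ i, 0 < k i) (hk : ∀ i, 2 * k i < k (i + 1)) {D : ℝ} (hD : D < -(1 / C₂)) :
    ∃ᶠ t in atTop, D ≤ tailExponent (oscLaw lam C₁ C₂ (Set.range k)) t := by
  have ht := tendsto_pow_comp_atTop hlam hk
  refine (Real.tendsto_exp_atTop.comp ht).frequently (Eventually.frequently ?_)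
  have hlim : Tendsto (fun i => -(1 / C₂) - Real.log (oscNorm lam C₁ C₂ (Set.range k)) / lam ^ k i)
      atTop (nhds (-(1 / C₂) - 0)) := (tendsto_const_nhds.div_atTop ht).const_sub _
  filter_upwards [hlim.eventually (lt_mem_nhds (show D < -(1 / C₂) - 0 by linarith))] with i hi
  have hp : 0 < lam ^ k i := by positivity
  have h := le_tailExponent_exp (S := Set.range k) hlam h₁ h₁₂ hp (hk0 i) le_rfl
    (oscWeight_of_mem (Set.mem_range_self i)).ge
  refine hi.le.trans (le_trans (le_of_eq ?_) h)
  have h₂ : 0 < C₂ := h₁.trans_le h₁₂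
  field_simp

/-- The first atom above `t` is at most `t ^ lam`, and an atom `x` always has unnormalized weight at
least `x ^ (-1 / C₁)`. -/
theorem eventually_le_tailExponent (hlam : 1 < lam) (h₁ : 0 < C₁) (h₁₂ : C₁ ≤ C₂) {D : ℝ}
    (hD : D < -(lam / C₁)) :
    ∀ᶠ t in atTop, D ≤ tailExponent (oscLaw lam C₁ C₂ S) t := by
  have hlim : Tendsto (fun t => -(lam / C₁) - Real.log (oscNorm lam C₁ C₂ S) / Real.log t)
      atTop (nhds (-(lam / C₁) - 0)) :=
    (tendsto_const_nhds.div_atTop Real.tendsto_log_atTop).const_sub _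
  filter_upwards [hlim.eventually (lt_mem_nhds (show D < -(lam / C₁) - 0 by linarith)),
    Real.tendsto_log_atTop.eventually_ge_atTop 1, eventually_gt_atTop 0] with t ht hs ht0
  obtain ⟨n, hn, hn'⟩ := exists_nat_pow_near hs hlam
  have hs0 : 0 < Real.log t := by linarith
  have h := le_tailExponent_exp (S := S) (a := lam * Real.log t / C₁) hlam h₁ h₁₂ hs0
    n.succ_pos hn'.le (by
      refine le_trans ?_ (le_oscWeight (by linarith) h₁ h₁₂ S _)
      rw [Real.exp_le_exp, neg_le_neg_iff, Nat.succ_eq_add_one, pow_succ']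
      exact div_le_div_of_nonneg_right (mul_le_mul_of_nonneg_left hn (by linarith)) h₁.le)
  rw [Real.exp_log ht0] at h
  refine ht.le.trans (le_trans (le_of_eq ?_) h)
  field_simp

theorem notMem_range_or_le (hk : ∀ i, 2 * k i < k (i + 1)) {i j : ℕ} (hj : k i < j) :
    j ∉ Set.range k ∨ 2 * k i + 1 ≤ j := by
  by_cases h : j ∈ Set.range k
  · obtain ⟨m, rfl⟩ := h
    have hm := strictMono_of_two_mul_lt hk
    have h1 : k (i + 1) ≤ k m := hm.monotone (hm.lt_iff_lt.1 hj)
    have := hk i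
    exact Or.inr (by omega)
  · exact Or.inl h

/-- Past the atom of index `k i`, light atoms start at log-height `lam * lam ^ k i`. Heavy ones are
higher by a further factor `lam ^ k i`, which by `hi` outweighs their slower decay. -/
theorem oscLaw_Ici_exp_succ_le (hlam : 1 < lam) (h₁ : 0 < C₁) (h₁₂ : C₁ ≤ C₂)
    (hk : ∀ i, 2 * k i < k (i + 1)) {γ : ℝ} (hγ : 0 < γ) {i : ℕ}
    (hi : 2 * C₂ * γ ≤ lam ^ k i) {c : ℝ} (hc : 0 < c) (hc₁ : c ≤ 1 / C₁ - γ)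
    (hc₂ : c ≤ 1 / (2 * C₂)) :
    (oscLaw lam C₁ C₂ (Set.range k)) (Set.Ici (Real.exp (lam ^ k i + 1))) ≤
      ENNReal.ofReal (Real.exp (-(γ * (lam * lam ^ k i))) *
        oscConst lam C₁ C₂ (Set.range k) c) := by
  have h₂ : 0 < C₂ := h₁.trans_le h₁₂
  refine oscLaw_Ici_le hlam h₁ h₁₂ hc (Real.exp_pos _).le fun j hj => ?_
  have hj' : lam ^ k i + 1 ≤ lam ^ j := Real.exp_le_exp.1 hj
  have hij : k i < j := (pow_lt_pow_iff_right₀ hlam).1 (by linarith)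
  have hpj : 0 < lam ^ j := by positivity
  rw [← Real.exp_add]
  rcases notMem_range_or_le hk hij with h | h
  · rw [oscWeight_of_notMem h, Real.exp_le_exp]
    have h3 : lam * lam ^ k i ≤ lam ^ j := by
      rw [← pow_succ']
      exact pow_le_pow_right₀ hlam.le hij
    have h4 := mul_le_mul_of_nonneg_left h3 hγ.le
    have h5 := mul_le_mul_of_nonneg_right hc₁ hpj.le
    have e : lam ^ j / C₁ = 1 / C₁ * lam ^ j := by ring
    rw [e]
    linarith
  · refine (oscWeight_le (by linarith) h₁ h₁₂ _ j).trans ?_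
    rw [Real.exp_le_exp]
    have h3 : lam ^ k i * (lam * lam ^ k i) ≤ lam ^ j := by
      refine le_trans (le_of_eq ?_) (pow_le_pow_right₀ hlam.le h)
      ring
    have h4 := mul_le_mul_of_nonneg_right hi (show 0 ≤ lam * lam ^ k i by positivity)
    have h5 := mul_le_mul_of_nonneg_right hc₂ hpj.le
    have h6 : γ * (lam * lam ^ k i) ≤ 1 / (2 * C₂) * lam ^ j := by
      rw [one_div, ← div_eq_inv_mul, le_div_iff₀ (by positivity)]
      linarith
    -- Half of the decay supplies the prefactor, the other half the summability.
    have e : lam ^ j / C₂ = 1 / (2 * C₂) * lam ^ j + 1 / (2 * C₂) * lam ^ j := by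
      field_simp
      norm_num
    rw [e]
    linarith

theorem frequently_tailExponent_le (hlam : 1 < lam) (h₁ : 0 < C₁) (h₁₂ : C₁ ≤ C₂)
    (hk : ∀ i, 2 * k i < k (i + 1)) {D : ℝ} (hD : -(lam / C₁) < D) :
    ∃ᶠ t in atTop, tailExponent (oscLaw lam C₁ C₂ (Set.range k)) t ≤ D := by
  have h₂ : 0 < C₂ := h₁.trans_le h₁₂
  have hlam0 : 0 < lam := by linarith
  obtain ⟨γ, hγ, hγ₁⟩ := exists_between (show max 0 (-D / lam) < 1 / C₁ from
    max_lt (by positivity) (by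
      rw [div_lt_div_iff₀ hlam0 h₁]
      rw [neg_lt, lt_div_iff₀ h₁] at hD
      linarith))
  have hγ0 := (le_max_left _ _).trans_lt hγ
  have hγD := (le_max_right _ _).trans_lt hγ
  rw [div_lt_iff₀ hlam0] at hγD
  set c := min (1 / C₁ - γ) (1 / (2 * C₂))
  have hc : 0 < c := lt_min (sub_pos.2 hγ₁) (by positivity)
  set K := oscConst lam C₁ C₂ (Set.range k) c
  have ht := tendsto_pow_comp_atTop hlam hk
  have ht1 : Tendsto (fun i => lam ^ k i + 1) atTop atTop := tendsto_atTop_add_const_right _ _ ht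
  -- The shift by `1` excludes the heavy atom itself and is negligible beside `lam ^ k i`.
  refine (Real.tendsto_exp_atTop.comp ht1).frequently (Eventually.frequently ?_)
  have hlim : Tendsto (fun i => -(γ * lam) + (γ * lam + Real.log K) / (lam ^ k i + 1))
      atTop (nhds (-(γ * lam) + 0)) := (tendsto_const_nhds.div_atTop ht1).const_add _
  filter_upwards [hlim.eventually (gt_mem_nhds (show -(γ * lam) + 0 < D by linarith)),
    ht.eventually_ge_atTop (2 * C₂ * γ)] with i hi hi2
  have hp : 0 < lam ^ k i + 1 := by positivity
  have h := tailExponent_exp_le hlam h₁ h₁₂ hp (oscConst_pos hlam h₁ h₁₂ _ hc)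
    (oscLaw_Ici_exp_succ_le hlam h₁ h₁₂ hk hγ0 hi2 hc (min_le_left _ _) (min_le_right _ _))
  refine h.trans (le_trans (le_of_eq ?_) hi.le)
  field_simp
  ring

theorem limsup_tailExponent (hlam : 1 < lam) (h₁ : 0 < C₁) (h₁₂ : C₁ ≤ C₂)
    (hk0 : ∀ i, 0 < k i) (hk : ∀ i, 2 * k i < k (i + 1)) :
    limsup (fun t : ℝ => (tailExponent (oscLaw lam C₁ C₂ (Set.range k)) t : EReal)) atTop
      = ((-(1 / C₂) : ℝ) : EReal) :=
  le_antisymm (limsup_coe_le_of_forall fun _ hD => eventually_tailExponent_le hlam h₁ h₁₂ hD)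
    (le_limsup_coe_of_forall fun _ hD => frequently_le_tailExponent hlam h₁ h₁₂ hk0 hk hD)

theorem liminf_tailExponent (hlam : 1 < lam) (h₁ : 0 < C₁) (h₁₂ : C₁ ≤ C₂)
    (hk : ∀ i, 2 * k i < k (i + 1)) :
    liminf (fun t : ℝ => (tailExponent (oscLaw lam C₁ C₂ (Set.range k)) t : EReal)) atTop
      = ((-(lam / C₁) : ℝ) : EReal) :=
  le_antisymm (liminf_coe_le_of_forall fun _ hD => frequently_tailExponent_le hlam h₁ h₁₂ hk hD)
    (le_liminf_coe_of_forall fun _ hD => eventually_le_tailExponent hlam h₁ h₁₂ hD)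

end

/-! ### Permanents of matrices with independent entries. -/

noncomputable section

variable {n : ℕ}

/-- A permutation meets `n` distinct positions, whose entries are independent. -/
theorem lintegral_prod_perm (μ : Measure ℝ) [IsProbabilityMeasure μ] {f : ℝ → ENNReal}
    (hf : Measurable f) (σ : Equiv.Perm (Fin n)) :
    ∫⁻ x : Fin n × Fin n → ℝ, ∏ i, f (x (σ i, i)) ∂(Measure.pi fun _ => μ)
      = (∫⁻ y, f y ∂μ) ^ n := by
  have hind : iIndepFun (fun (ij : Fin n × Fin n) (x : Fin n × Fin n → ℝ) => f (x ij))
      (Measure.pi fun _ => μ) := iIndepFun_pi fun _ => hf.aemeasurable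
  have hinj : Function.Injective fun i : Fin n => (σ i, i) := fun i j h => (Prod.ext_iff.1 h).2
  rw [lintegral_prod_eq_prod_lintegral_of_indepFun Finset.univ _ (hind.precomp hinj)
    (fun i => hf.comp (measurable_pi_apply _))]
  rw [Finset.prod_congr rfl fun i _ =>
    (measurePreserving_eval (fun _ : Fin n × Fin n => μ) (σ i, i)).lintegral_comp hf]
  simp

theorem lintegral_permanent (μ : Measure ℝ) [IsProbabilityMeasure μ] {f : ℝ → ENNReal}
    (hf : Measurable f) :
    ∫⁻ x : Fin n × Fin n → ℝ, (Matrix.of fun i j => f (x (i, j))).permanent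
      ∂(Measure.pi fun _ => μ) = n.factorial * (∫⁻ y, f y ∂μ) ^ n := by
  simp only [Matrix.permanent, Matrix.of_apply]
  rw [lintegral_finsetSum]
  · simp [lintegral_prod_perm μ hf, Fintype.card_perm]
  · intro σ _
    exact Finset.measurable_prod _ fun i _ => hf.comp (measurable_pi_apply _)

theorem ofReal_permanent_rpow_le {β : ℝ} (hβ : 0 < β) (hβ₁ : β ≤ 1) (M : Matrix (Fin n) (Fin n) ℝ)
    (hM : ∀ i j, 0 ≤ M i j) :
    ENNReal.ofReal M.permanent ^ β ≤
      (Matrix.of fun i j => ENNReal.ofReal (M i j ^ β)).permanent := by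
  simp only [Matrix.permanent, Matrix.of_apply]
  rw [ENNReal.ofReal_sum_of_nonneg fun σ _ => Finset.prod_nonneg fun i _ => hM _ _]
  refine (Finset.le_sum_of_subadditive (fun a : ENNReal => a ^ β)
    (by simp [ENNReal.zero_rpow_of_pos hβ])
    (fun a b => ENNReal.rpow_add_le_add_rpow a b hβ.le hβ₁) _ _).trans (le_of_eq ?_)
  refine Finset.sum_congr rfl fun σ _ => ?_
  rw [ENNReal.ofReal_prod_of_nonneg fun i _ => hM _ _, ← ENNReal.prod_rpow_of_nonneg hβ.le]
  exact Finset.prod_congr rfl fun i _ => ENNReal.ofReal_rpow_of_nonneg (hM _ _) hβ.le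

/-- Markov's inequality for the permanent, through its moment of order `β`, on the event that all
entries lie in `G`. -/
theorem pi_le_permanent_le (μ : Measure ℝ) [IsProbabilityMeasure μ] {β : ℝ} (hβ : 0 < β)
    (hβ₁ : β ≤ 1) {G : Set ℝ} (hG : MeasurableSet G) (hG0 : ∀ x ∈ G, 0 ≤ x) {m : ℝ} (hm : 0 ≤ m)
    (hμ : ∫⁻ y, ENNReal.ofReal (G.indicator (fun y => y ^ β) y) ∂μ ≤ ENNReal.ofReal m) (s : ℝ) :
    (Measure.pi fun _ : Fin n × Fin n => μ)
      {x | Real.exp s ≤ (Matrix.of fun i j => x (i, j)).permanent ∧ ∀ ij, x ij ∈ G} ≤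
      ENNReal.ofReal (n.factorial * m ^ n * Real.exp (-(β * s))) := by
  set f : ℝ → ENNReal := fun y => ENNReal.ofReal (G.indicator (fun y => y ^ β) y)
  have hf : Measurable f := by
    refine ENNReal.measurable_ofReal.comp (Measurable.indicator ?_ hG)
    fun_prop
  set F : (Fin n × Fin n → ℝ) → ENNReal := fun x => (Matrix.of fun i j => f (x (i, j))).permanent
  have hF : Measurable F := by
    simp only [F, Matrix.permanent, Matrix.of_apply]
    exact Finset.measurable_sum _ fun σ _ => Finset.measurable_prod _ fun i _ =>
      hf.comp (measurable_pi_apply _)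
  have hsub : {x : Fin n × Fin n → ℝ |
      Real.exp s ≤ (Matrix.of fun i j => x (i, j)).permanent ∧ ∀ ij, x ij ∈ G} ⊆
      {x | ENNReal.ofReal (Real.exp (β * s)) ≤ F x} := by
    rintro x ⟨hx, hxG⟩
    have h1 := ofReal_permanent_rpow_le hβ hβ₁ (Matrix.of fun i j => x (i, j))
      fun i j => hG0 _ (hxG (i, j))
    have h2 : F x = (Matrix.of fun i j =>
        ENNReal.ofReal ((Matrix.of fun i j => x (i, j)) i j ^ β)).permanent := by
      simp only [F, f]
      congr 2
      ext i j
      rw [Set.indicator_of_mem (hxG (i, j)), Matrix.of_apply]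
    change _ ≤ F x
    rw [h2]
    refine le_trans ?_ h1
    rw [mul_comm, Real.exp_mul, ← ENNReal.ofReal_rpow_of_nonneg (Real.exp_pos s).le hβ.le]
    exact ENNReal.rpow_le_rpow (ENNReal.ofReal_le_ofReal hx) hβ.le
  refine (measure_mono hsub).trans ?_
  have h := mul_meas_ge_le_lintegral (μ := Measure.pi fun _ : Fin n × Fin n => μ) hF
    (ENNReal.ofReal (Real.exp (β * s)))
  rw [lintegral_permanent μ hf] at h
  have h3 : (n.factorial : ENNReal) * (∫⁻ y, f y ∂μ) ^ n
      ≤ ENNReal.ofReal (n.factorial * m ^ n) := by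
    rw [ENNReal.ofReal_mul (by positivity), ENNReal.ofReal_natCast, ENNReal.ofReal_pow hm]
    gcongr
  have hpos : ENNReal.ofReal (Real.exp (β * s)) ≠ 0 := by
    simp [Real.exp_pos]
  rw [Real.exp_neg, ← div_eq_mul_inv, ENNReal.ofReal_div_of_pos (Real.exp_pos _),
    ENNReal.le_div_iff_mul_le (Or.inl hpos) (Or.inl ENNReal.ofReal_ne_top), mul_comm]
  exact h.trans h3

/-- A permutation with the largest number of entries satisfying `b` leaves a square block without
any such entry. -/
theorem exists_perm_block (b : Fin n → Fin n → Prop) :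
    ∃ (σ : Equiv.Perm (Fin n)) (U : Finset (Fin n)),
      (∀ i, i ∉ U → b (σ i) i) ∧ ∀ i ∈ U, ∀ j ∈ U, ¬ b (σ i) j := by
  classical
  obtain ⟨σ, -, hσ⟩ := Finset.exists_max_image (Finset.univ : Finset (Equiv.Perm (Fin n)))
    (fun σ => (Finset.univ.filter fun i => b (σ i) i).card) ⟨1, Finset.mem_univ _⟩
  refine ⟨σ, Finset.univ.filter fun i => ¬ b (σ i) i, fun i hi => ?_, fun i hi j hj hb => ?_⟩
  · simpa using hi
  · simp only [Finset.mem_filter, Finset.mem_univ, true_and] at hi hj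
    -- Composing with the swap makes column `j` good and spoils none, since `i` and `j` were both
    -- bad; this contradicts maximality.
    refine absurd (hσ (σ * Equiv.swap i j) (Finset.mem_univ _)) (not_le.2 (Finset.card_lt_card ?_))
    rw [Finset.ssubset_iff_of_subset]
    · refine ⟨j, ?_, ?_⟩
      · rw [Finset.mem_filter, Equiv.Perm.mul_apply, Equiv.swap_apply_right]
        exact ⟨Finset.mem_univ _, hb⟩
      · simpa using hj
    · intro x hx
      simp only [Finset.mem_filter, Finset.mem_univ, true_and] at hx ⊢
      have hxi : x ≠ i := fun h => hi (h ▸ hx)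
      have hxj : x ≠ j := fun h => hj (h ▸ hx)
      rwa [Equiv.Perm.mul_apply, Equiv.swap_apply_of_ne_of_ne hxi hxj]

theorem one_le_permanent {M : Matrix (Fin n) (Fin n) ℝ} (hM : ∀ i j, 1 ≤ M i j) :
    1 ≤ M.permanent := by
  refine le_trans ?_ (Finset.single_le_sum (f := fun σ : Equiv.Perm (Fin n) => ∏ i, M (σ i) i)
    (fun σ _ => Finset.prod_nonneg fun i _ => zero_le_one.trans (hM _ _)) (Finset.mem_univ 1))
  exact le_trans (by simp) (Finset.prod_le_prod (f := fun _ => (1 : ℝ))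
    (fun _ _ => zero_le_one) fun i _ => hM _ _)

/-- If every block of entries below `exp s` with more than `a` rows and columns is excluded, the
permanent is large. -/
theorem le_log_permanent {M : Matrix (Fin n) (Fin n) ℝ} (hM : ∀ i j, 1 ≤ M i j) {s a : ℝ}
    (hs : 0 ≤ s)
    (h : ¬ ∃ U V : Finset (Fin n), a < U.card ∧ a < V.card ∧
      ∀ i ∈ U, ∀ j ∈ V, M i j < Real.exp s) :
    (n - a) * s ≤ Real.log M.permanent := by
  obtain ⟨σ, U, hU, hU'⟩ := exists_perm_block fun i j => Real.exp s ≤ M i j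
  have hUa : (U.card : ℝ) ≤ a := by
    by_contra! hlt
    -- The block missed by the maximal permutation has rows `σ(U)` and columns `U`.
    refine h ⟨U.map σ.toEmbedding, U, by simpa using hlt, hlt, fun i hi j hj => ?_⟩
    obtain ⟨i', hi', rfl⟩ := Finset.mem_map.1 hi
    exact not_le.1 (hU' i' hi' j hj)
  have hprod : Real.exp ((n - a) * s) ≤ ∏ i, M (σ i) i := by
    rw [← Finset.prod_mul_prod_compl U]
    have h1 : 1 ≤ ∏ i ∈ U, M (σ i) i := by
      refine le_trans (by simp) (Finset.prod_le_prod (f := fun _ => (1 : ℝ))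
        (fun _ _ => zero_le_one) fun i _ => hM (σ i) i)
    have h2 : Real.exp s ^ Uᶜ.card ≤ ∏ i ∈ Uᶜ, M (σ i) i := by
      rw [← Finset.prod_const]
      exact Finset.prod_le_prod (fun _ _ => (Real.exp_pos s).le)
        fun i hi => hU i (Finset.mem_compl.1 hi)
    have h3 : Real.exp ((n - a) * s) ≤ Real.exp s ^ Uᶜ.card := by
      rw [← Real.exp_nat_mul, Real.exp_le_exp]
      refine mul_le_mul_of_nonneg_right ?_ hs
      rw [Finset.card_compl, Fintype.card_fin, Nat.cast_sub (by simpa using U.card_le_univ)]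
      linarith
    calc Real.exp ((n - a) * s) ≤ 1 * ∏ i ∈ Uᶜ, M (σ i) i := by
          rw [one_mul]
          exact h3.trans h2
      _ ≤ _ := mul_le_mul_of_nonneg_right h1
          (Finset.prod_nonneg fun i _ => zero_le_one.trans (hM _ _))
  rw [Real.le_log_iff_exp_le (zero_lt_one.trans_le (one_le_permanent hM))]
  exact hprod.trans (Finset.single_le_sum
    (f := fun σ : Equiv.Perm (Fin n) => ∏ i, M (σ i) i)
    (fun σ _ => Finset.prod_nonneg fun i _ => zero_le_one.trans (hM _ _)) (Finset.mem_univ σ))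

/-- Independence over the block, with `1 - p ≤ exp (-p)` for each entry. -/
theorem pi_block_le (μ : Measure ℝ) [IsProbabilityMeasure μ] {t p : ℝ}
    (hp : p ≤ μ.real (Set.Ici t)) (U V : Finset (Fin n)) :
    (Measure.pi fun _ : Fin n × Fin n => μ) {x | ∀ i ∈ U, ∀ j ∈ V, x (i, j) < t} ≤
      ENNReal.ofReal (Real.exp (-(p * (U.card * V.card)))) := by
  classical
  have hset : {x : Fin n × Fin n → ℝ | ∀ i ∈ U, ∀ j ∈ V, x (i, j) < t} =
      Set.univ.pi fun ij => if ij ∈ U ×ˢ V then Set.Iio t else Set.univ := by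
    ext x
    simp only [Set.mem_ofPred_eq, Set.mem_univ_pi, Finset.mem_product]
    constructor
    · intro h ij
      split_ifs with hij
      · exact h _ hij.1 _ hij.2
      · trivial
    · intro h i hi j hj
      simpa [hi, hj] using h (i, j)
  have hIio : μ (Set.Iio t) ≤ ENNReal.ofReal (Real.exp (-p)) := by
    rw [← Set.compl_Ici, ← ofReal_measureReal, probReal_compl_eq_one_sub measurableSet_Ici]
    refine ENNReal.ofReal_le_ofReal ?_
    have := Real.add_one_le_exp (-p)
    linarith
  rw [hset, Measure.pi_pi]
  have : ∀ ij : Fin n × Fin n, μ (if ij ∈ U ×ˢ V then Set.Iio t else Set.univ)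
      = if ij ∈ U ×ˢ V then μ (Set.Iio t) else 1 := by
    intro ij
    split_ifs <;> simp
  simp only [this]
  rw [Finset.prod_ite_mem, Finset.univ_inter, Finset.prod_const, Finset.card_product]
  refine (pow_le_pow_left' hIio _).trans (le_of_eq ?_)
  rw [← ENNReal.ofReal_pow (Real.exp_pos _).le, ← Real.exp_nat_mul]
  push_cast
  ring_nf

/-- Union bound over the `2 ^ n * 2 ^ n` pairs of row and column sets. -/
theorem pi_exists_block_le (μ : Measure ℝ) [IsProbabilityMeasure μ] {t p a : ℝ} (hp0 : 0 ≤ p)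
    (ha : 0 ≤ a) (hp : p ≤ μ.real (Set.Ici t)) :
    (Measure.pi fun _ : Fin n × Fin n => μ)
      {x | ∃ U V : Finset (Fin n), a < U.card ∧ a < V.card ∧
        ∀ i ∈ U, ∀ j ∈ V, x (i, j) < t} ≤
      ENNReal.ofReal (4 ^ n * Real.exp (-(p * (a * a)))) := by
  have hsub : {x : Fin n × Fin n → ℝ | ∃ U V : Finset (Fin n), a < U.card ∧ a < V.card ∧
        ∀ i ∈ U, ∀ j ∈ V, x (i, j) < t} ⊆
      ⋃ W : Finset (Fin n) × Finset (Fin n),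
        {x | (a < W.1.card ∧ a < W.2.card) ∧ ∀ i ∈ W.1, ∀ j ∈ W.2, x (i, j) < t} := by
    rintro x ⟨U, V, hU, hV, h⟩
    exact Set.mem_iUnion.2 ⟨(U, V), ⟨hU, hV⟩, h⟩
  refine (measure_mono hsub).trans ((measure_iUnion_fintype_le _ _).trans ?_)
  have hle : ∀ W : Finset (Fin n) × Finset (Fin n),
      (Measure.pi fun _ : Fin n × Fin n => μ)
        {x | (a < W.1.card ∧ a < W.2.card) ∧ ∀ i ∈ W.1, ∀ j ∈ W.2, x (i, j) < t} ≤
      ENNReal.ofReal (Real.exp (-(p * (a * a)))) := by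
    intro W
    by_cases hW : a < W.1.card ∧ a < W.2.card
    · refine (measure_mono fun x hx => hx.2).trans ((pi_block_le μ hp W.1 W.2).trans ?_)
      refine ENNReal.ofReal_le_ofReal (Real.exp_le_exp.2 (neg_le_neg ?_))
      exact mul_le_mul_of_nonneg_left
        (mul_le_mul hW.1.le hW.2.le ha (ha.trans hW.1.le)) hp0
    · simp [hW]
  refine (Finset.sum_le_sum fun W _ => hle W).trans (le_of_eq ?_)
  rw [Finset.sum_const, Finset.card_univ, Fintype.card_prod, Fintype.card_finset, Fintype.card_fin,
    nsmul_eq_mul, ENNReal.ofReal_mul (by positivity), ENNReal.ofReal_pow (by norm_num)]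
  congr 1
  rw [← mul_pow]
  norm_num

/-! ### Matrix sequences and Borel–Cantelli. -/

section MatrixSequence

variable {Ω : Type*} [MeasurableSpace Ω] {P : Measure Ω} {μ : Measure ℝ}
  {A : (n : ℕ) → Ω → Matrix (Fin n) (Fin n) ℝ}

theorem IsIIDMatrixSequence.map_eq_pi [IsProbabilityMeasure P] (hA : IsIIDMatrixSequence P μ A) (n : ℕ) :
    P.map (fun ω (ij : Fin n × Fin n) => A n ω ij.1 ij.2) = Measure.pi fun _ => μ := by
  have h := (iIndepFun_iff_map_fun_eq_pi_map
    (fun ij : Fin n × Fin n => (hA.hasLaw n ij.1 ij.2).aemeasurable)).1 (hA.indep n)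
  rw [h]
  congr
  ext1 ij
  exact (hA.hasLaw n ij.1 ij.2).map_eq

/-- Events about the `n`-th matrix are bounded by their probability under the product measure. -/
theorem IsIIDMatrixSequence.measure_le [IsProbabilityMeasure P]
    (hA : IsIIDMatrixSequence P μ A) (n : ℕ)
    (E : Set (Fin n × Fin n → ℝ)) :
    P {ω | (fun ij : Fin n × Fin n => A n ω ij.1 ij.2) ∈ E} ≤ (Measure.pi fun _ => μ) E := by
  rw [← hA.map_eq_pi n]
  -- Only an inequality is needed, so `E` need not be measurable.
  exact Measure.le_map_apply
    (aemeasurable_pi_lambda _ fun ij => (hA.hasLaw n ij.1 ij.2).aemeasurable) E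

theorem IsIIDMatrixSequence.ae_forall (hA : IsIIDMatrixSequence P μ A) {p : ℝ → Prop}
    (hp : ∀ᵐ x ∂μ, p x) : ∀ᵐ ω ∂P, ∀ n (i j : Fin n), p (A n ω i j) := by
  refine ae_all_iff.2 fun n => ae_all_iff.2 fun i => ae_all_iff.2 fun j => ?_
  rw [← (hA.hasLaw n i j).map_eq] at hp
  exact ae_of_ae_map (hA.hasLaw n i j).aemeasurable hp

/-- The Borel–Cantelli lemma with an eventual real bound. -/
theorem ae_eventually_notMem_of_le {E : ℕ → Set Ω} {a : ℕ → ℝ} (ha : Summable a)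
    (h : ∀ᶠ i in atTop, P (E i) ≤ ENNReal.ofReal (a i)) : ∀ᵐ ω ∂P, ∀ᶠ i in atTop, ω ∉ E i := by
  obtain ⟨N, hN⟩ := eventually_atTop.1 h
  have hs : ∑' i, P (E (i + N)) ≠ ⊤ := by
    refine ne_top_of_le_ne_top ?_ (ENNReal.tsum_le_tsum fun i => hN (i + N) (by omega))
    exact ((summable_nat_add_iff N).2 ha).tsum_ofReal_ne_top
  filter_upwards [ae_eventually_notMem hs] with ω hω
  rw [← map_add_atTop_eq_nat N]
  exact hω

end MatrixSequence

theorem exists_isIIDMatrixSequence (μ : Measure ℝ) [IsProbabilityMeasure μ] :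
    ∃ (Ω : Type) (_ : MeasurableSpace Ω) (P : Measure Ω)
      (A : (n : ℕ) → Ω → Matrix (Fin n) (Fin n) ℝ),
      IsProbabilityMeasure P ∧ IsIIDMatrixSequence P μ A := by
  obtain ⟨Ω, mΩ, P, X, -, hX, hind, hP⟩ := exists_iid (Σ n : ℕ, Fin n × Fin n) μ
  refine ⟨Ω, mΩ, P, fun n ω i j => X ⟨n, i, j⟩ ω, hP, fun n i j => hX _, fun n => ?_⟩
  exact hind.precomp (g := fun ij : Fin n × Fin n => (⟨n, ij⟩ : Σ n : ℕ, Fin n × Fin n))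
    fun _ _ h => eq_of_heq (Sigma.mk.inj h).2

end

/-! ### Almost sure bounds for the permanent. -/

noncomputable section

section RationalLevels

variable {Ω : Type*} [MeasurableSpace Ω] {P : Measure Ω} {Q : ℝ → Ω → Prop} {C : ℝ}

/-- Monotonicity in the level reduces uncountably many null sets to those at rational levels. -/
theorem ae_forall_gt_of_forall_gt (hQ : ∀ ω D D', D ≤ D' → Q D ω → Q D' ω)
    (h : ∀ D, C < D → ∀ᵐ ω ∂P, Q D ω) : ∀ᵐ ω ∂P, ∀ D, C < D → Q D ω := by
  have h' : ∀ᵐ ω ∂P, ∀ q : ℚ, C < q → Q q ω :=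
    ae_all_iff.2 fun q => eventually_imp_distrib_left.2 fun hq => h q hq
  filter_upwards [h'] with ω hω D hD
  obtain ⟨q, hq, hqD⟩ := exists_rat_btwn hD
  exact hQ ω q D hqD.le (hω q hq)

theorem ae_forall_lt_of_forall_lt (hQ : ∀ ω D D', D' ≤ D → Q D ω → Q D' ω)
    (h : ∀ D, D < C → ∀ᵐ ω ∂P, Q D ω) : ∀ᵐ ω ∂P, ∀ D, D < C → Q D ω := by
  have h' : ∀ᵐ ω ∂P, ∀ q : ℚ, (q : ℝ) < C → Q q ω :=
    ae_all_iff.2 fun q => eventually_imp_distrib_left.2 fun hq => h q hq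
  filter_upwards [h'] with ω hω D hD
  obtain ⟨q, hq, hqD⟩ := exists_rat_btwn hD
  exact hQ ω q D hq.le (hω q hqD)

end RationalLevels

theorem logPermRatio_le_of_permanent_lt {n : ℕ} (hn : 1 < n) {M : Matrix (Fin n) (Fin n) ℝ}
    (hM : 1 ≤ M.permanent) {D : ℝ} (h : M.permanent < Real.exp (D * (n * Real.log n))) :
    logPermRatio M ≤ D := by
  have hn' : (1 : ℝ) < n := by exact_mod_cast hn
  have hlog := Real.log_pos hn'
  rw [logPermRatio, div_le_iff₀ (by positivity)]
  exact ((Real.log_lt_iff_lt_exp (by linarith)).2 h).le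

theorem factorial_mul_pow_mul_exp_le {n : ℕ} (hn : 0 < n) {M q : ℝ} (hM : 0 ≤ M)
    (h : M * Real.exp (-((q - 1) * Real.log n)) ≤ 1 / 2) :
    n.factorial * M ^ n * Real.exp (-(q * (n * Real.log n))) ≤ (1 / 2) ^ n := by
  have hn' : (0 : ℝ) < n := by exact_mod_cast hn
  have h1 : (n.factorial : ℝ) ≤ Real.exp (Real.log n) ^ n := by
    rw [Real.exp_log hn']
    exact_mod_cast Nat.factorial_le_pow n
  calc n.factorial * M ^ n * Real.exp (-(q * (n * Real.log n)))
      ≤ Real.exp (Real.log n) ^ n * M ^ n * Real.exp (-(q * (n * Real.log n))) := by gcongr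
    _ = (M * Real.exp (-((q - 1) * Real.log n))) ^ n := by
        rw [mul_pow, ← Real.exp_nat_mul, ← Real.exp_nat_mul, mul_comm (Real.exp _) (M ^ n),
          mul_assoc, ← Real.exp_add]
        congr 2
        ring
    _ ≤ _ := pow_le_pow_left₀ (by positivity) h n

/-- The crude bound `n ≥ L` already gives decay that is summable when `L` is a multiple of `lam ^ k
i`. -/
theorem half_pow_natCeil_exp_le {n : ℕ} {L : ℝ} (hn : n = ⌈Real.exp L⌉₊) :
    (1 / 2 : ℝ) ^ n ≤ Real.exp (-(Real.log 2 * L)) := by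
  have h1 : L ≤ n := by
    have h2 : Real.exp L ≤ n := hn ▸ Nat.le_ceil _
    linarith [Real.add_one_le_exp L]
  rw [one_div, inv_pow, Real.exp_neg]
  refine inv_anti₀ (Real.exp_pos _) ?_
  rw [Real.exp_mul, Real.exp_log two_pos, ← Real.rpow_natCast]
  exact Real.rpow_le_rpow_of_exponent_le one_le_two h1

theorem natCeil_exp_le {L : ℝ} (hL : 0 ≤ L) : (⌈Real.exp L⌉₊ : ℝ) ≤ 2 * Real.exp L := by
  have := Nat.ceil_lt_add_one (Real.exp_pos L).le
  linarith [Real.one_le_exp hL]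

theorem tendsto_natCeil_exp {L : ℕ → ℝ} (hL : Tendsto L atTop atTop) :
    Tendsto (fun i => ⌈Real.exp (L i)⌉₊) atTop atTop :=
  tendsto_nat_ceil_atTop.comp (Real.tendsto_exp_atTop.comp hL)

variable {lam C₁ C₂ : ℝ} {S : Set ℕ} {k : ℕ → ℕ}
variable {Ω : Type*} [MeasurableSpace Ω] {P : Measure Ω} [IsProbabilityMeasure P]
  {A : (n : ℕ) → Ω → Matrix (Fin n) (Fin n) ℝ}

omit [IsProbabilityMeasure P] in
theorem ae_one_le_entries (hlam : 0 ≤ lam)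
    (hA : IsIIDMatrixSequence P (oscLaw lam C₁ C₂ S) A) :
    ∀ᵐ ω ∂P, ∀ n (i j : Fin n), 1 ≤ A n ω i j :=
  hA.ae_forall (ae_oscLaw_of_forall fun _ => one_le_oscAtom hlam _)

theorem oscAtom_rpow (lam : ℝ) (j : ℕ) (β : ℝ) : oscAtom lam j ^ β = Real.exp (β * lam ^ j) := by
  rw [oscAtom, ← Real.exp_mul, mul_comm]

theorem lintegral_rpow_oscLaw_le (hlam : 1 < lam) (h₁ : 0 < C₁) (h₁₂ : C₁ ≤ C₂) {β : ℝ}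
    (hβ : β < 1 / C₂) :
    ∫⁻ y, ENNReal.ofReal ((Set.Ici 0).indicator (fun y => y ^ β) y) ∂(oscLaw lam C₁ C₂ S) ≤
      ENNReal.ofReal (1 * oscConst lam C₁ C₂ S (1 / C₂ - β)) := by
  refine lintegral_oscLaw_le hlam h₁ h₁₂ (sub_pos.2 hβ) zero_le_one fun j => ?_
  rw [Set.indicator_of_mem (show oscAtom lam j ∈ Set.Ici 0 from (Real.exp_pos _).le), oscAtom_rpow]
  refine (mul_le_mul_of_nonneg_right (oscWeight_le (by linarith) h₁ h₁₂ S j)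
    (Real.exp_pos _).le).trans (le_of_eq ?_)
  rw [← Real.exp_add, one_mul]
  congr 1
  ring

/-- The moment of order `β < 1 / C₁`, truncated at the atom with index `k (i + 1)`. -/
theorem lintegral_rpow_truncated_oscLaw_le (hlam : 1 < lam) (h₁ : 0 < C₁) (h₁₂ : C₁ ≤ C₂)
    (hk : StrictMono k) {β : ℝ} (hβ : β < 1 / C₁) (i : ℕ) :
    ∫⁻ y, ENNReal.ofReal ((Set.Ico 0 (oscAtom lam (k (i + 1)))).indicator (fun y => y ^ β) y)
      ∂(oscLaw lam C₁ C₂ (Set.range k)) ≤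
      ENNReal.ofReal (Real.exp (1 / C₁ * lam ^ k i) *
        oscConst lam C₁ C₂ (Set.range k) (1 / C₁ - β)) := by
  have h₂ : 0 < C₂ := h₁.trans_le h₁₂
  refine lintegral_oscLaw_le hlam h₁ h₁₂ (sub_pos.2 hβ) (Real.exp_pos _).le fun j => ?_
  by_cases hj : oscAtom lam j ∈ Set.Ico 0 (oscAtom lam (k (i + 1)))
  · rw [Set.indicator_of_mem hj, oscAtom_rpow, ← Real.exp_add]
    have hjk : j < k (i + 1) := (pow_lt_pow_iff_right₀ hlam).1 (Real.exp_lt_exp.1 hj.2)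
    have hpi : 0 ≤ 1 / C₁ * lam ^ k i := by positivity
    -- A heavy atom here has index at most `k i`; the prefactor `exp (lam ^ k i / C₁)` pays for its
    -- missing decay.
    by_cases hjS : j ∈ Set.range k
    · obtain ⟨m, rfl⟩ := hjS
      have hm : m ≤ i := Nat.lt_succ_iff.1 (hk.lt_iff_lt.1 hjk)
      have hpow : lam ^ k m ≤ lam ^ k i := pow_le_pow_right₀ hlam.le (hk.monotone hm)
      have h3 := mul_le_mul_of_nonneg_left hpow (show 0 ≤ 1 / C₁ by positivity)
      rw [oscWeight_of_mem (Set.mem_range_self m), ← Real.exp_add, Real.exp_le_exp]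
      have : 0 ≤ lam ^ k m / C₂ := by positivity
      linarith
    · rw [oscWeight_of_notMem hjS, ← Real.exp_add, Real.exp_le_exp]
      have e : lam ^ j / C₁ = 1 / C₁ * lam ^ j := by ring
      rw [e]
      linarith
  · rw [Set.indicator_of_notMem hj, mul_zero]
    positivity

theorem ae_eventually_logPermRatio_le (hlam : 1 < lam) (h₁ : 1 < C₁) (h₁₂ : C₁ ≤ C₂)
    (hA : IsIIDMatrixSequence P (oscLaw lam C₁ C₂ S) A) {D : ℝ} (hD : C₂ < D) :
    ∀ᵐ ω ∂P, ∀ᶠ n in atTop, logPermRatio (A n ω) ≤ D := by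
  have h₁' : 0 < C₁ := by linarith
  have h₂ : 0 < C₂ := by linarith
  have hD0 : 0 < D := h₂.trans hD
  have := isProbabilityMeasure_oscLaw hlam h₁' h₁₂ S
  obtain ⟨β, hβD, hβ⟩ := exists_between (one_div_lt_one_div_of_lt h₂ hD)
  have hβ0 : 0 < β := (one_div_pos.2 hD0).trans hβD
  -- Subadditivity of `x ^ β` needs `β ≤ 1`; this is where `1 < C₁` enters.
  have hβ1 : β ≤ 1 := hβ.le.trans (by rw [div_le_one h₂]; linarith)
  have hq : 1 < β * D := (div_lt_iff₀ hD0).1 hβD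
  set K := 1 * oscConst lam C₁ C₂ S (1 / C₂ - β) with hKdef
  have hK : 0 < K := by
    rw [hKdef, one_mul]
    exact oscConst_pos hlam h₁' h₁₂ S (sub_pos.2 hβ)
  have hlim : Tendsto (fun n : ℕ => K * Real.exp (-((β * D - 1) * Real.log n))) atTop
      (nhds (K * 0)) := by
    refine (Real.tendsto_exp_neg_atTop_nhds_zero.comp ?_).const_mul K
    exact (Real.tendsto_log_atTop.comp tendsto_natCast_atTop_atTop).const_mul_atTop
      (sub_pos.2 hq)
  have hev : ∀ᶠ n : ℕ in atTop, P {ω | (fun ij : Fin n × Fin n => A n ω ij.1 ij.2) ∈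
      {x : Fin n × Fin n → ℝ | Real.exp (D * (n * Real.log n)) ≤
        (Matrix.of fun i j => x (i, j)).permanent ∧ ∀ ij, x ij ∈ Set.Ici 0}} ≤
      ENNReal.ofReal ((1 / 2) ^ n) := by
    filter_upwards [hlim.eventually (gt_mem_nhds (show K * 0 < 1 / 2 by norm_num)),
      eventually_gt_atTop 0] with n hn hn0
    refine (hA.measure_le n _).trans ((pi_le_permanent_le _ hβ0 hβ1 measurableSet_Ici
      (fun x hx => hx) hK.le (lintegral_rpow_oscLaw_le hlam h₁' h₁₂ hβ) _).trans
      (ENNReal.ofReal_le_ofReal ?_))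
    rw [← mul_assoc β D]
    exact factorial_mul_pow_mul_exp_le hn0 hK.le hn.le
  filter_upwards [ae_eventually_notMem_of_le
    (summable_geometric_of_lt_one (by norm_num) (by norm_num)) hev,
    ae_one_le_entries (by linarith) hA] with ω hω hω1
  filter_upwards [hω, eventually_gt_atTop 1] with n hn hn1
  refine logPermRatio_le_of_permanent_lt hn1 (one_le_permanent (hω1 n)) ?_
  by_contra! hle
  exact hn ⟨hle, fun ij => zero_le_one.trans (hω1 n ij.1 ij.2)⟩

theorem pi_exists_ge_le (μ : Measure ℝ) [IsProbabilityMeasure μ] (n : ℕ) (t : ℝ) :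
    (Measure.pi fun _ : Fin n × Fin n => μ) {x | ∃ ij, t ≤ x ij} ≤
      (n * n : ℕ) * μ (Set.Ici t) := by
  rw [Set.ofPred_exists]
  refine (measure_iUnion_fintype_le _ _).trans (le_of_eq ?_)
  have : ∀ ij : Fin n × Fin n,
      (Measure.pi fun _ : Fin n × Fin n => μ) {x | t ≤ x ij} = μ (Set.Ici t) := fun ij =>
    (measurePreserving_eval (fun _ : Fin n × Fin n => μ) ij).measure_preimage
      measurableSet_Ici.nullMeasurableSet
  simp [this]

theorem ae_frequently_logPermRatio_le (hlam : 1 < lam) (h₁ : 1 < C₁) (h₁₂ : C₁ ≤ C₂)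
    (hk : ∀ i, 2 * k i < k (i + 1))
    (hA : IsIIDMatrixSequence P (oscLaw lam C₁ C₂ (Set.range k)) A) {D : ℝ} (hD : C₁ < D) :
    ∀ᵐ ω ∂P, ∃ᶠ n in atTop, logPermRatio (A n ω) ≤ D := by
  have h₁' : 0 < C₁ := by linarith
  have h₂ : 0 < C₂ := by linarith
  have hD0 : 0 < D := h₁'.trans hD
  have hmono := strictMono_of_two_mul_lt hk
  have := isProbabilityMeasure_oscLaw hlam h₁' h₁₂ (Set.range k)
  obtain ⟨β, hβD, hβ⟩ := exists_between (one_div_lt_one_div_of_lt h₁' hD)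
  have hβ0 : 0 < β := (one_div_pos.2 hD0).trans hβD
  have hβ1 : β ≤ 1 := hβ.le.trans (by rw [div_le_one h₁']; linarith)
  have hq : 0 < β * D - 1 := sub_pos.2 ((div_lt_iff₀ hD0).1 hβD)
  set K := oscConst lam C₁ C₂ (Set.range k) (1 / C₁ - β)
  have hK : 0 < K := oscConst_pos hlam h₁' h₁₂ _ (sub_pos.2 hβ)
  have hγ : 3 / (4 * C₂) < 1 / C₂ := by
    rw [div_lt_div_iff₀ (by positivity) h₂]
    linarith
  set K' := oscConst lam C₁ C₂ (Set.range k) (1 / C₂ - 3 / (4 * C₂))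
  have hK' : 0 < K' := oscConst_pos hlam h₁' h₁₂ _ (sub_pos.2 hγ)
  have ht := tendsto_pow_comp_atTop hlam hk
  -- The `N ^ 2` entries cost `exp (2 * b * lam ^ k (i + 1))` up to a constant, against a tail of
  -- order `exp (-(3 * b * lam ^ k (i + 1)))`; a summable factor with rate `b` remains.
  set b : ℝ := 1 / (4 * C₂) with hb
  have hb0 : 0 < b := by positivity
  set L : ℕ → ℝ := fun i => b * lam ^ k (i + 1)
  have hL0 : ∀ i, 0 ≤ L i := fun i => by positivity
  have hL : Tendsto L atTop atTop := (ht.comp (tendsto_add_atTop_nat 1)).const_mul_atTop hb0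
  set N : ℕ → ℕ := fun i => ⌈Real.exp (L i)⌉₊
  have hN : Tendsto N atTop atTop := tendsto_natCeil_exp hL
  have hNL : ∀ i, Real.exp (L i) ≤ N i := fun i => Nat.le_ceil _
  have hsum : ∀ c : ℝ, 0 < c → Summable fun i : ℕ => Real.exp (-(c * lam ^ k (i + 1))) :=
    fun c hc => (summable_exp_neg_mul_pow hc hlam).comp_injective
      (hmono.injective.comp (add_left_injective 1))
  -- the permanent is small as long as the entries stay below the atom with index `k (i + 1)`
  have hev₁ : ∀ᶠ i : ℕ in atTop, P {ω | (fun ij : Fin (N i) × Fin (N i) => A (N i) ω ij.1 ij.2) ∈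
      {x : Fin (N i) × Fin (N i) → ℝ | Real.exp (D * (N i * Real.log (N i))) ≤
        (Matrix.of fun a c => x (a, c)).permanent ∧
          ∀ ij, x ij ∈ Set.Ico 0 (oscAtom lam (k (i + 1)))}} ≤
      ENNReal.ofReal (Real.exp (-(Real.log 2 * b * lam ^ k (i + 1)))) := by
    filter_upwards [ht.eventually_ge_atTop 1, ht.eventually_ge_atTop (Real.log (2 * K)),
      -- The `1 / C₁` cancels the truncated moment; the extra `1` leaves `lam ^ k i` to absorb `log
      -- (2 * K)`.
      (ht.const_mul_atTop (mul_pos hq hb0)).eventually_ge_atTop (1 / C₁ + 1)] with i hi1 hi2 hi3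
    have hN0 : (0 : ℝ) < N i := (Real.exp_pos _).trans_le (hNL i)
    refine (hA.measure_le _ _).trans ((pi_le_permanent_le _ hβ0 hβ1 measurableSet_Ico
      (fun x hx => hx.1) (by positivity)
      (lintegral_rpow_truncated_oscLaw_le hlam h₁' h₁₂ hmono hβ i) _).trans
      (ENNReal.ofReal_le_ofReal ?_))
    have hhalf := half_pow_natCeil_exp_le (n := N i) (L := L i) rfl
    rw [mul_assoc (Real.log 2) b]
    refine le_trans ?_ hhalf
    rw [← mul_assoc β D]
    refine factorial_mul_pow_mul_exp_le (by exact_mod_cast hN0) (by positivity) ?_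
    have hlog : L i ≤ Real.log (N i) := (Real.le_log_iff_exp_le hN0).2 (hNL i)
    have hpow : lam ^ k i * lam ^ k i ≤ lam ^ k (i + 1) := by
      rw [← pow_add]
      exact pow_le_pow_right₀ hlam.le (by have := hk i; omega)
    have hexp : 1 / C₁ * lam ^ k i + -((β * D - 1) * Real.log (N i)) ≤ -Real.log (2 * K) := by
      have h3 := mul_le_mul_of_nonneg_left hlog hq.le
      have h4 := mul_le_mul_of_nonneg_left hpow (mul_pos hq hb0).le
      have h5 := mul_le_mul_of_nonneg_right hi3 (show 0 ≤ lam ^ k i by linarith)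
      have h6 : (β * D - 1) * L i = (β * D - 1) * b * lam ^ k (i + 1) := by
        simp only [L]
        ring
      linarith
    calc Real.exp (1 / C₁ * lam ^ k i) * K * Real.exp (-((β * D - 1) * Real.log (N i)))
        = K * Real.exp (1 / C₁ * lam ^ k i + -((β * D - 1) * Real.log (N i))) := by
          rw [Real.exp_add]
          ring
      _ ≤ K * Real.exp (-Real.log (2 * K)) := by gcongr
      _ = 1 / 2 := by
          rw [Real.exp_neg, Real.exp_log (by positivity)]
          field_simp
  have hev₂ : ∀ᶠ i : ℕ in atTop, P {ω | (fun ij : Fin (N i) × Fin (N i) => A (N i) ω ij.1 ij.2) ∈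
      {x : Fin (N i) × Fin (N i) → ℝ | ∃ ij, oscAtom lam (k (i + 1)) ≤ x ij}} ≤
      ENNReal.ofReal (4 * K' * Real.exp (-(b * lam ^ k (i + 1)))) := by
    refine Eventually.of_forall fun i => (hA.measure_le _ _).trans ((pi_exists_ge_le _ _ _).trans
      ((mul_le_mul_right (oscLaw_Ici_le_exp hlam h₁' h₁₂ (by positivity) hγ) _).trans ?_))
    rw [← ENNReal.ofReal_natCast, ← ENNReal.ofReal_mul (by positivity)]
    refine ENNReal.ofReal_le_ofReal ?_
    have hN2 : (N i : ℝ) ≤ 2 * Real.exp (L i) := natCeil_exp_le (hL0 i)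
    calc ((N i * N i : ℕ) : ℝ) * (Real.exp (-(3 / (4 * C₂) * lam ^ k (i + 1))) * K')
        ≤ (2 * Real.exp (L i)) * (2 * Real.exp (L i)) *
            (Real.exp (-(3 / (4 * C₂) * lam ^ k (i + 1))) * K') := by
          push_cast
          gcongr
      _ = 4 * K' * (Real.exp (L i) * Real.exp (L i) *
            Real.exp (-(3 / (4 * C₂) * lam ^ k (i + 1)))) := by ring
      _ = _ := by
          rw [← Real.exp_add, ← Real.exp_add]
          congr 2
          simp only [L, hb]
          ring
  filter_upwards [ae_eventually_notMem_of_le (hsum _ (mul_pos (Real.log_pos one_lt_two) hb0)) hev₁,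
    ae_eventually_notMem_of_le ((hsum b hb0).mul_left _) hev₂,
    ae_one_le_entries (by linarith) hA] with ω hω₁ hω₂ hω
  refine hN.frequently (Eventually.frequently ?_)
  filter_upwards [hω₁, hω₂, hN.eventually_gt_atTop 1] with i hi₁ hi₂ hi
  refine logPermRatio_le_of_permanent_lt hi (one_le_permanent (hω _)) ?_
  by_contra! hle
  refine hi₁ ⟨hle, fun ij => ⟨zero_le_one.trans (hω _ ij.1 ij.2), ?_⟩⟩
  by_contra! hge
  exact hi₂ ⟨ij, hge⟩

theorem ae_frequently_le_logPermRatio (hlam : 1 < lam) (h₁ : 1 < C₁) (h₁₂ : C₁ ≤ C₂)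
    (hk0 : ∀ i, 0 < k i) (hk : ∀ i, 2 * k i < k (i + 1))
    (hA : IsIIDMatrixSequence P (oscLaw lam C₁ C₂ (Set.range k)) A) {D : ℝ} (hD : D < C₂) :
    ∀ᵐ ω ∂P, ∃ᶠ n in atTop, D ≤ logPermRatio (A n ω) := by
  have h₁' : 0 < C₁ := by linarith
  have h₂ : 0 < C₂ := by linarith
  -- Nonnegativity allows the upper bound on `log N` to be multiplied by `D`.
  wlog hD0 : 0 ≤ D generalizing D
  · filter_upwards [this h₂ le_rfl] with ω hω
    exact hω.mono fun n hn => (not_le.1 hD0).le.trans hn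
  have hmono := strictMono_of_two_mul_lt hk
  have := isProbabilityMeasure_oscLaw hlam h₁' h₁₂ (Set.range k)
  -- The condition on `δ` says `D * (1 + δ) < C₂ * (1 - δ)`.
  obtain ⟨δ, hδ0, hδ⟩ := exists_between (show 0 < (C₂ - D) / (C₂ + D) from
    div_pos (by linarith) (by linarith))
  rw [lt_div_iff₀ (by linarith)] at hδ
  set Z := oscNorm lam C₁ C₂ (Set.range k)
  have hZ : 0 < Z := oscNorm_pos hlam h₁' h₁₂ _
  have ht := tendsto_pow_comp_atTop hlam hk
  -- With this rate, `N` times the mass of the heavy atom still grows like `exp (δ / C₂ * lam ^ k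
  -- i)`.
  set b : ℝ := (1 + δ) / C₂ with hb
  have hb0 : 0 < b := by positivity
  set L : ℕ → ℝ := fun i => b * lam ^ k i
  have hL0 : ∀ i, 0 ≤ L i := fun i => by positivity
  have hL : Tendsto L atTop atTop := ht.const_mul_atTop hb0
  set N : ℕ → ℕ := fun i => ⌈Real.exp (L i)⌉₊
  have hN : Tendsto N atTop atTop := tendsto_natCeil_exp hL
  have hNL : ∀ i, Real.exp (L i) ≤ N i := fun i => Nat.le_ceil _
  have hsum : Summable fun i : ℕ => Real.exp (-(Real.log 2 * b * lam ^ k i)) :=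
    (summable_exp_neg_mul_pow (mul_pos (Real.log_pos one_lt_two) hb0) hlam).comp_injective
      hmono.injective
  have hlim : Tendsto (fun i => δ * δ / Z * Real.exp (δ / C₂ * lam ^ k i)) atTop atTop :=
    (Real.tendsto_exp_atTop.comp (ht.const_mul_atTop (by positivity))).const_mul_atTop
      (by positivity)
  have hev : ∀ᶠ i : ℕ in atTop, P {ω | (fun ij : Fin (N i) × Fin (N i) => A (N i) ω ij.1 ij.2) ∈
      {x : Fin (N i) × Fin (N i) → ℝ | ∃ U V : Finset (Fin (N i)),
        δ * N i < U.card ∧ δ * N i < V.card ∧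
          ∀ a ∈ U, ∀ c ∈ V, x (a, c) < oscAtom lam (k i)}} ≤
      ENNReal.ofReal (Real.exp (-(Real.log 2 * b * lam ^ k i))) := by
    -- The `8` beats the `4 ^ N` of the union bound and leaves `(1 / 2) ^ N`.
    filter_upwards [hlim.eventually_ge_atTop (Real.log 8)] with i hi
    have hp := le_oscLaw_Ici (S := Set.range k) hlam h₁' h₁₂ (hk0 i) le_rfl
    rw [oscWeight_of_mem (Set.mem_range_self i)] at hp
    refine (hA.measure_le _ _).trans ((pi_exists_block_le _ (by positivity) (by positivity)
      hp).trans (ENNReal.ofReal_le_ofReal ?_))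
    have hhalf := half_pow_natCeil_exp_le (n := N i) (L := L i) rfl
    rw [mul_assoc (Real.log 2) b]
    refine le_trans ?_ hhalf
    set p := Real.exp (-(lam ^ k i / C₂)) / Z
    have hpN : Real.log 8 ≤ δ * δ * p * N i := by
      refine hi.trans ?_
      calc δ * δ / Z * Real.exp (δ / C₂ * lam ^ k i)
          = δ * δ * p * Real.exp (L i) := by
            have e : Real.exp (δ / C₂ * lam ^ k i)
                = Real.exp (-(lam ^ k i / C₂)) * Real.exp (L i) := by
              rw [← Real.exp_add]
              congr 1
              simp only [L, hb]
              ring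
            rw [e]
            simp only [p]
            ring
        _ ≤ _ := mul_le_mul_of_nonneg_left (hNL i) (by positivity)
    calc 4 ^ N i * Real.exp (-(p * (δ * N i * (δ * N i))))
        = (4 * Real.exp (-(δ * δ * p * N i))) ^ N i := by
          rw [mul_pow, ← Real.exp_nat_mul]
          congr 2
          ring
      _ ≤ (4 * Real.exp (-Real.log 8)) ^ N i := by gcongr
      _ = (1 / 2) ^ N i := by
          rw [Real.exp_neg, Real.exp_log (by norm_num)]
          norm_num
  have hc : 0 < (1 - δ) - D * b := by
    have : D * b = D * (1 + δ) / C₂ := by rw [hb, mul_div_assoc]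
    rw [this, sub_pos, div_lt_iff₀ h₂]
    linarith
  filter_upwards [ae_eventually_notMem_of_le hsum hev, ae_one_le_entries (by linarith) hA]
    with ω hω hω1
  refine hN.frequently (Eventually.frequently ?_)
  filter_upwards [hω, hN.eventually_gt_atTop 1,
    -- The slack `hc` absorbs the factor `2` lost in rounding `N` up.
    (ht.const_mul_atTop hc).eventually_ge_atTop (D * Real.log 2)] with i hi hi1 hi2
  have hN1 : (1 : ℝ) < N i := by exact_mod_cast hi1
  have hlogN := Real.log_pos hN1
  have h := le_log_permanent (hω1 (N i)) (s := lam ^ k i) (a := δ * N i) (by positivity) hi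
  rw [logPermRatio, le_div_iff₀ (by positivity)]
  refine le_trans ?_ h
  have hlogle : Real.log (N i) ≤ Real.log 2 + L i := by
    rw [← Real.log_exp (L i), ← Real.log_mul two_ne_zero (Real.exp_ne_zero _)]
    exact Real.log_le_log (by linarith) (natCeil_exp_le (hL0 i))
  have h3 : D * Real.log (N i) ≤ (1 - δ) * lam ^ k i := by
    refine (mul_le_mul_of_nonneg_left hlogle hD0).trans ?_
    simp only [L]
    linarith
  have h4 := mul_le_mul_of_nonneg_left h3 (show (0 : ℝ) ≤ N i by linarith)
  linarith

theorem ae_liminf_limsup_logPermRatio (hlam : 1 < lam) (h₁ : 1 < C₁) (h₁₂ : C₁ < C₂)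
    (hk0 : ∀ i, 0 < k i) (hk : ∀ i, 2 * k i < k (i + 1))
    (hA : IsIIDMatrixSequence P (oscLaw lam C₁ C₂ (Set.range k)) A) :
    ∀ᵐ ω ∂P,
      liminf (fun n : ℕ => (logPermRatio (A n ω) : EReal)) atTop ≤ (C₁ : EReal) ∧
      limsup (fun n : ℕ => (logPermRatio (A n ω) : EReal)) atTop = (C₂ : EReal) ∧
      ¬ ∃ L : EReal, Tendsto (fun n : ℕ => (logPermRatio (A n ω) : EReal)) atTop (nhds L) := by
  have hlo := ae_forall_gt_of_forall_gt
    (Q := fun D ω => ∃ᶠ n in atTop, logPermRatio (A n ω) ≤ D)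
    (fun ω D D' hDD' h => h.mono fun n hn => hn.trans hDD')
    (fun D hD => ae_frequently_logPermRatio_le hlam h₁ h₁₂.le hk hA hD)
  have hup := ae_forall_gt_of_forall_gt
    (Q := fun D ω => ∀ᶠ n in atTop, logPermRatio (A n ω) ≤ D)
    (fun ω D D' hDD' h => h.mono fun n hn => hn.trans hDD')
    (fun D hD => ae_eventually_logPermRatio_le hlam h₁ h₁₂.le hA hD)
  have hfr := ae_forall_lt_of_forall_lt
    (Q := fun D ω => ∃ᶠ n in atTop, D ≤ logPermRatio (A n ω))
    (fun ω D D' hDD' h => h.mono fun n hn => hDD'.trans hn)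
    (fun D hD => ae_frequently_le_logPermRatio hlam h₁ h₁₂.le hk0 hk hA hD)
  filter_upwards [hlo, hup, hfr] with ω hlo hup hfr
  have hinf := liminf_coe_le_of_forall hlo
  have hsup := le_antisymm (limsup_coe_le_of_forall hup) (le_limsup_coe_of_forall hfr)
  refine ⟨hinf, hsup, ?_⟩
  rintro ⟨L, hL⟩
  rw [hL.liminf_eq] at hinf
  rw [hL.limsup_eq] at hsup
  rw [hsup] at hinf
  exact absurd (EReal.coe_le_coe_iff.1 hinf) (not_le.2 h₁₂)

/-- With `lam = 1 + δ` and `C₂ = C₁ + δ` the gap is continuous in `δ` and vanishes at `0`. -/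
theorem exists_lam_small_gap (h₁ : 1 < C₁) {ε : ℝ} (hε : 0 < ε) :
    ∃ lam C₂ : ℝ, 1 < lam ∧ lam < C₁ ∧ C₁ < C₂ ∧ -(1 / C₂) < -(lam / C₁) + ε := by
  have h₁' : C₁ ≠ 0 := by linarith
  have hlim : Tendsto (fun δ : ℝ => (1 + δ) / C₁ - 1 / (C₁ + δ)) (nhds 0)
      (nhds ((1 + 0) / C₁ - 1 / (C₁ + 0))) := by
    have : ContinuousAt (fun δ : ℝ => (1 + δ) / C₁ - 1 / (C₁ + δ)) 0 := by
      fun_prop (disch := simpa)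
    exact this
  have h0 : (1 + 0) / C₁ - 1 / (C₁ + 0) = 0 := by simp
  rw [h0] at hlim
  have hev : ∀ᶠ δ : ℝ in nhdsWithin 0 (Set.Ioi 0),
      ((1 + δ) / C₁ - 1 / (C₁ + δ) < ε ∧ δ < C₁ - 1) ∧ 0 < δ :=
    (((hlim.eventually (gt_mem_nhds hε)).and (gt_mem_nhds (sub_pos.2 h₁))).filter_mono
      nhdsWithin_le_nhds).and self_mem_nhdsWithin
  obtain ⟨δ, ⟨hδ, hδ1⟩, hδ0⟩ := hev.exists
  exact ⟨1 + δ, C₁ + δ, by linarith, by linarith, by linarith, by linarith⟩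

end
-- The main theorem.
theorem mainTheorem5 (C₁ : ℝ) (hC₁ : 1 < C₁) (k : ℕ → ℕ) (hk0 : ∀ i, 0 < k i)
    (hk : ∀ i, 2 * k i < k (i + 1)) :
    (∀ lam C₂ : ℝ, 1 < lam → lam < C₁ → C₁ < C₂ →
      Summable (fun j : ℕ => oscWeight lam C₁ C₂ (Set.range k) (j + 1)) ∧
      IsProbabilityMeasure (oscLaw lam C₁ C₂ (Set.range k)) ∧
      (∀ᵐ x ∂(oscLaw lam C₁ C₂ (Set.range k)), 0 < x) ∧
      liminf (fun t : ℝ => (tailExponent (oscLaw lam C₁ C₂ (Set.range k)) t : EReal)) atTop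
        = ((-(lam / C₁) : ℝ) : EReal) ∧
      limsup (fun t : ℝ => (tailExponent (oscLaw lam C₁ C₂ (Set.range k)) t : EReal)) atTop
        = ((-(1 / C₂) : ℝ) : EReal) ∧
      -(lam / C₁) < -(1 / C₂) ∧
      (∃ (Ω : Type) (_ : MeasurableSpace Ω) (P : Measure Ω)
          (A : (n : ℕ) → Ω → Matrix (Fin n) (Fin n) ℝ),
        IsProbabilityMeasure P ∧
          IsIIDMatrixSequence P (oscLaw lam C₁ C₂ (Set.range k)) A) ∧
      (∀ (Ω : Type*) [MeasurableSpace Ω] (P : Measure Ω) [IsProbabilityMeasure P]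
          (A : (n : ℕ) → Ω → Matrix (Fin n) (Fin n) ℝ),
        IsIIDMatrixSequence P (oscLaw lam C₁ C₂ (Set.range k)) A →
          ∀ᵐ ω ∂P,
            liminf (fun n : ℕ => (logPermRatio (A n ω) : EReal)) atTop ≤ (C₁ : EReal) ∧
            limsup (fun n : ℕ => (logPermRatio (A n ω) : EReal)) atTop = (C₂ : EReal) ∧
            ¬ ∃ L : EReal,
              Tendsto (fun n : ℕ => (logPermRatio (A n ω) : EReal)) atTop (nhds L))) ∧
    (∀ ε : ℝ, 0 < ε → ∃ lam C₂ : ℝ, 1 < lam ∧ lam < C₁ ∧ C₁ < C₂ ∧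
      limsup (fun t : ℝ => (tailExponent (oscLaw lam C₁ C₂ (Set.range k)) t : EReal)) atTop
        < liminf (fun t : ℝ => (tailExponent (oscLaw lam C₁ C₂ (Set.range k)) t : EReal)) atTop
          + (ε : EReal))
 := by
  have h₁ : 0 < C₁ := by linarith
  refine ⟨fun lam C₂ hlam hlamC h₁₂ => ?_, fun ε hε => ?_⟩
  · have h₂ : 0 < C₂ := h₁.trans h₁₂
    have := isProbabilityMeasure_oscLaw hlam h₁ h₁₂.le (Set.range k)
    refine ⟨summable_oscWeight hlam h₁ h₁₂.le _, this,
      ae_oscLaw_of_forall fun _ => Real.exp_pos _,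
      liminf_tailExponent hlam h₁ h₁₂.le hk, limsup_tailExponent hlam h₁ h₁₂.le hk0 hk, ?_,
      exists_isIIDMatrixSequence _, fun Ω _ P _ A hA =>
        ae_liminf_limsup_logPermRatio hlam hC₁ h₁₂ hk0 hk hA⟩
    rw [neg_lt_neg_iff, div_lt_div_iff₀ h₂ h₁]
    nlinarith
  · obtain ⟨lam, C₂, hlam, hlamC, h₁₂, h⟩ := exists_lam_small_gap hC₁ hε
    refine ⟨lam, C₂, hlam, hlamC, h₁₂, ?_⟩
    rw [liminf_tailExponent hlam h₁ h₁₂.le hk, limsup_tailExponent hlam h₁ h₁₂.le hk0 hk,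
      ← EReal.coe_add]
    exact EReal.coe_lt_coe_iff.2 h
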